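/- Let $R$ be an associative ring with unit. An $\mathcal R$-module is a covariant additive functor from the category of (left) $R$-modules to the category of abelian groups; morphisms of $\mathcal R$-modules are natural transformations. Let $\langle\text{Qs-ch}\rangle$ be the full subcategory of the category of $\mathcal R$-modules whose objects are the $\mathcal R$-modules that preserve direct limits (colimits of direct systems indexed by upward directed sets). For a right $R$-module $M$, the quasi-coherent $\mathcal R$-module associated with $M$ is the functor $\mathcal M(S)=M\otimes_R S$. A morphism $N\to N'$ of right $R$-modules is pure if $N\otimes_R S\to N'\otimes_R S$ is injective for every $R$-module $S$, and a right $R$-module $M$ is pure-injective if for every pure morphism $N\to N'$ the induced map $\operatorname{Hom}_R(N',M)\to\operatorname{Hom}_R(N,M)$ is surjective. Proposition. Let $\mathbb M$ be an $\mathcal R$-module. Then $\mathbb M$ belongs to $\langle\text{Qs-ch}\rangle$ and is an injective object of $\langle\text{Qs-ch}\rangle$ if and only if $\mathbb M$ is isomorphic to the quasi-coherent $\mathcal R$-module associated with some pure-injective right $R$-module. -/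

import Mathlib

universe u

open CategoryTheory CategoryTheory.Limits MulOpposite
open scoped TensorProduct

noncomputable section

namespace QsCh

/-! ### Tensor products over a noncommutative ring

Right `R`-modules are modules over `Rᵐᵒᵖ`, so that `m · r` is `op r • m`. -/

section Tensor

variable (R : Type u) [Ring R]

/-- The subgroup of `M ⊗[ℤ] S` generated by all `(m · r) ⊗ s - m ⊗ (r • s)`. -/
def balancedRel (M : Type u) [AddCommGroup M] [Module Rᵐᵒᵖ M]
    (S : Type u) [AddCommGroup S] [Module R S] : Submodule ℤ (M ⊗[ℤ] S) :=
  Submodule.span ℤ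
    {x | ∃ (m : M) (r : R) (s : S), x = (op r • m) ⊗ₜ[ℤ] s - m ⊗ₜ[ℤ] (r • s)}

/-- The abelian group `M ⊗_R S`, for a right `R`-module `M` and a left `R`-module `S`. -/
abbrev RTensor (M : Type u) [AddCommGroup M] [Module Rᵐᵒᵖ M]
    (S : Type u) [AddCommGroup S] [Module R S] : Type u :=
  (M ⊗[ℤ] S) ⧸ balancedRel R M S

variable {R}
variable {M M' M'' : Type u} [AddCommGroup M] [Module Rᵐᵒᵖ M] [AddCommGroup M'] [Module Rᵐᵒᵖ M']
  [AddCommGroup M''] [Module Rᵐᵒᵖ M'']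
variable {S S' S'' : Type u} [AddCommGroup S] [Module R S] [AddCommGroup S'] [Module R S']
  [AddCommGroup S''] [Module R S'']

/-- The pure tensor `m ⊗ s` in `M ⊗_R S`. -/
def rtmul (R : Type u) [Ring R] {M : Type u} [AddCommGroup M] [Module Rᵐᵒᵖ M]
    {S : Type u} [AddCommGroup S] [Module R S] (m : M) (s : S) : RTensor R M S :=
  Submodule.Quotient.mk (m ⊗ₜ[ℤ] s)

theorem balancedRel_le_comap (f : M →ₗ[Rᵐᵒᵖ] M') (g : S →ₗ[R] S') :
    balancedRel R M S ≤ (balancedRel R M' S').comap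
      (TensorProduct.map f.toAddMonoidHom.toIntLinearMap g.toAddMonoidHom.toIntLinearMap) := by
  refine Submodule.span_le.2 ?_
  rintro _ ⟨m, r, s, rfl⟩
  refine Submodule.subset_span ⟨f m, r, g s, ?_⟩
  simp

/-- The homomorphism `f ⊗ g : M ⊗_R S → M' ⊗_R S'`. -/
def rtmap (f : M →ₗ[Rᵐᵒᵖ] M') (g : S →ₗ[R] S') : RTensor R M S →ₗ[ℤ] RTensor R M' S' :=
  (balancedRel R M S).mapQ (balancedRel R M' S')
    (TensorProduct.map f.toAddMonoidHom.toIntLinearMap g.toAddMonoidHom.toIntLinearMap)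
    (balancedRel_le_comap f g)

@[simp]
theorem rtmap_rtmul (f : M →ₗ[Rᵐᵒᵖ] M') (g : S →ₗ[R] S') (m : M) (s : S) :
    rtmap f g (rtmul R m s) = rtmul R (f m) (g s) := rfl

theorem rtensor_hom_ext {A : Type u} [AddCommGroup A] {φ ψ : RTensor R M S →ₗ[ℤ] A}
    (h : ∀ m s, φ (rtmul R m s) = ψ (rtmul R m s)) : φ = ψ := by
  refine Submodule.linearMap_qext _ (TensorProduct.ext' fun m s => h m s)

theorem rtmap_id : rtmap (LinearMap.id : M →ₗ[Rᵐᵒᵖ] M) (LinearMap.id : S →ₗ[R] S) =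
    LinearMap.id :=
  rtensor_hom_ext fun _ _ => rfl

theorem rtmap_comp (f : M →ₗ[Rᵐᵒᵖ] M') (f' : M' →ₗ[Rᵐᵒᵖ] M'') (g : S →ₗ[R] S')
    (g' : S' →ₗ[R] S'') :
    rtmap (f' ∘ₗ f) (g' ∘ₗ g) = rtmap f' g' ∘ₗ rtmap f g :=
  rtensor_hom_ext fun _ _ => rfl

theorem rtmap_add_right (f : M →ₗ[Rᵐᵒᵖ] M') (g g' : S →ₗ[R] S') :
    rtmap f (g + g') = rtmap f g + rtmap f g' :=
  rtensor_hom_ext fun m s =>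
    congrArg (Submodule.Quotient.mk) (TensorProduct.tmul_add (f m) (g s) (g' s))

end Tensor

section Functors

variable (R : Type u) [Ring R]

/-- `𝓡`-modules: additive covariant functors from left `R`-modules to abelian groups. -/
abbrev FunctorModule := ModuleCat.{u} R ⥤+ AddCommGrpCat.{u}

variable {R} in
/-- The quasi-coherent `𝓡`-module `S ↦ M ⊗_R S` associated with a right `R`-module `M`,
as a plain functor. -/
def quasiCoherentFunctor (M : ModuleCat.{u} Rᵐᵒᵖ) : ModuleCat.{u} R ⥤ AddCommGrpCat.{u} where
  obj S := AddCommGrpCat.of (RTensor R M S)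
  map g := AddCommGrpCat.ofHom (rtmap (LinearMap.id : M →ₗ[Rᵐᵒᵖ] M) g.hom).toAddMonoidHom
  map_id S := by
    ext x
    exact LinearMap.congr_fun (rtmap_id (R := R) (M := M) (S := S)) x
  map_comp g g' := by
    ext x
    exact LinearMap.congr_fun
      (rtmap_comp (LinearMap.id : M →ₗ[Rᵐᵒᵖ] M) LinearMap.id g.hom g'.hom) x

instance (M : ModuleCat.{u} Rᵐᵒᵖ) : (quasiCoherentFunctor M).Additive where
  map_add {_ _ g g'} := by
    ext x
    exact LinearMap.congr_fun (rtmap_add_right (LinearMap.id : M →ₗ[Rᵐᵒᵖ] M) g.hom g'.hom) x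

variable {R} in
/-- The quasi-coherent `𝓡`-module associated with a right `R`-module `M`. -/
def quasiCoherent (M : ModuleCat.{u} Rᵐᵒᵖ) : FunctorModule R :=
  AdditiveFunctor.of (quasiCoherentFunctor M)

/-- `F` preserves direct limits: it preserves colimits indexed by (nonempty, upward) directed
sets. -/
def PreservesDirectLimits : ObjectProperty (FunctorModule R) := fun F =>
  ∀ (I : Type u) [Preorder I] [IsDirectedOrder I] [Nonempty I], PreservesColimitsOfShape I F.obj

/-- The full subcategory of `𝓡`-modules whose objects preserve direct limits. -/
abbrev DirectLimitFunctor := (PreservesDirectLimits R).FullSubcategory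

end Functors

section Pure

variable {R : Type u} [Ring R]

/-- A morphism `f : N → N'` of right `R`-modules is pure if `f ⊗ S : N ⊗_R S → N' ⊗_R S` is
injective for every left `R`-module `S`. -/
def IsPure {N N' : ModuleCat.{u} Rᵐᵒᵖ} (f : N ⟶ N') : Prop :=
  ∀ S : ModuleCat.{u} R,
    Function.Injective (rtmap (R := R) f.hom (LinearMap.id : S →ₗ[R] S))

/-- A right `R`-module `M` is pure-injective if `Hom(N', M) → Hom(N, M)` is surjective for every
pure morphism `N → N'`. -/
def IsPureInjective (M : ModuleCat.{u} Rᵐᵒᵖ) : Prop :=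
  ∀ ⦃N N' : ModuleCat.{u} Rᵐᵒᵖ⦄ (f : N ⟶ N'), IsPure f →
    Function.Surjective fun h : N' ⟶ M => f ≫ h

end Pure

end QsCh

end

/-! A functor preserving direct limits is governed by its values on finitely presented modules,
since every module is a direct limit of these.

Let F be injective. For g : B ⟶ C between finitely presented modules, `factoring g` embeds into
Hom(B, -). Extending along this embedding the transformation given by an element of F(C), and
applying Yoneda, shows that F is right exact on finitely presented modules
(`rightExactOnFP_of_injective`). So F(R) ⊗_R A → F(A), bijective for A = R^n, is bijective for every
finitely presented A, and F is quasi-coherent. Pure maps induce monomorphisms of quasi-coherent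
functors, so F(R) is pure-injective.

Conversely, let M* = Hom(M, ℚ/ℤ) and D(S) = Hom(Hom_R(S, M*), ℚ/ℤ). By Yoneda, transformations F → D
are characters of F(M*), so they extend along transformations injective at M*; monomorphisms of the
subcategory are pointwise injective (`injective_of_mono`). D is right exact on finitely presented
modules, so any Y → D with Y preserving direct limits lifts to D(R) ⊗_R -
(`exists_lift_of_bijective`). Finally M → D(R) is pure, hence split when M is pure-injective, and a
retraction carries the extension back to M ⊗_R -. -/

noncomputable section

namespace QsCh

/-! ### Elementwise description of directed colimits -/

section DirectedColimits

variable {I : Type u} [Preorder I] [IsDirectedOrder I] [Nonempty I]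

/-- Elements with the same image are compared through their difference at a common stage, so only
kernels need testing. -/
theorem nonempty_isColimit_addCommGrp (K : I ⥤ AddCommGrpCat.{u}) (c : Cocone K)
    (hs : ∀ x : c.pt, ∃ j, ∃ y : K.obj j, c.ι.app j y = x)
    (hk : ∀ j (y : K.obj j), c.ι.app j y = 0 → ∃ (k : I) (f : j ⟶ k), K.map f y = 0) :
    Nonempty (IsColimit c) := by
  have : ReflectsColimitsOfShape I (forget AddCommGrpCat.{u}) :=
    reflectsColimitsOfShape_of_reflectsIsomorphisms
  refine ⟨isColimitOfReflects (forget AddCommGrpCat.{u}) (Types.FilteredColimit.isColimitOf _ _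
    (fun x => ?_) fun i j x y h => ?_)⟩
  · obtain ⟨j, y, rfl⟩ := hs x
    exact ⟨j, y, rfl⟩
  · obtain ⟨k, hik, hjk⟩ := exists_ge_ge i j
    let x' : K.obj k := K.map (homOfLE hik) x
    let y' : K.obj k := K.map (homOfLE hjk) y
    have hx : c.ι.app k x' = c.ι.app i x :=
      ConcreteCategory.congr_hom (c.w (homOfLE hik)) x
    have hy : c.ι.app k y' = c.ι.app j y :=
      ConcreteCategory.congr_hom (c.w (homOfLE hjk)) y
    have h' : c.ι.app i x = c.ι.app j y := h
    obtain ⟨l, f, hl⟩ := hk k (x' - y') (by rw [map_sub, hx, hy, h', sub_self])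
    rw [map_sub, sub_eq_zero] at hl
    refine ⟨l, homOfLE hik ≫ f, homOfLE hjk ≫ f, ?_⟩
    change K.map _ x = K.map _ y
    rw [K.map_comp, K.map_comp]
    exact hl

theorem nonempty_isColimit_moduleCat {R : Type u} [Ring R] (K : I ⥤ ModuleCat.{u} R)
    (c : Cocone K)
    (hs : ∀ x : c.pt, ∃ j, ∃ y : K.obj j, c.ι.app j y = x)
    (hk : ∀ j (y : K.obj j), c.ι.app j y = 0 → ∃ (k : I) (f : j ⟶ k), K.map f y = 0) :
    Nonempty (IsColimit c) := by
  have : ReflectsColimitsOfShape I (forget₂ (ModuleCat.{u} R) AddCommGrpCat.{u}) :=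
    reflectsColimitsOfShape_of_reflectsIsomorphisms
  obtain ⟨h⟩ := nonempty_isColimit_addCommGrp
    (K ⋙ forget₂ (ModuleCat.{u} R) AddCommGrpCat.{u}) ((forget₂ _ _).mapCocone c) hs hk
  exact ⟨isColimitOfReflects (forget₂ (ModuleCat.{u} R) AddCommGrpCat.{u}) h⟩

theorem exists_map_eq_zero {K : I ⥤ AddCommGrpCat.{u}} {c : Cocone K} (hc : IsColimit c)
    {j : I} (y : K.obj j) (h : c.ι.app j y = 0) : ∃ (k : I) (f : j ⟶ k), K.map f y = 0 := by
  obtain ⟨k, f, g, hfg⟩ := Concrete.isColimit_exists_of_rep_eq K hc y (0 : K.obj j)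
    (by rw [h, map_zero])
  exact ⟨k, f, by rw [hfg, map_zero]⟩

end DirectedColimits

section Criterion

variable {R : Type u} [Ring R]

theorem preservesDirectLimits_of_elementwise (F : FunctorModule R)
    (h : ∀ (I : Type u) [Preorder I] [IsDirectedOrder I] [Nonempty I] (K : I ⥤ ModuleCat.{u} R)
      (c : Cocone K), IsColimit c →
      (∀ x : F.obj.obj c.pt, ∃ j, ∃ y : F.obj.obj (K.obj j), F.obj.map (c.ι.app j) y = x) ∧
      ∀ j (y : F.obj.obj (K.obj j)), F.obj.map (c.ι.app j) y = 0 →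
        ∃ (k : I) (f : j ⟶ k), F.obj.map (K.map f) y = 0) :
    PreservesDirectLimits R F := by
  intro I _ _ _
  refine ⟨fun {K} => ⟨fun {c} hc => ?_⟩⟩
  obtain ⟨h₁, h₂⟩ := h I K c hc
  exact nonempty_isColimit_addCommGrp (K ⋙ F.obj) (F.obj.mapCocone c) h₁ h₂

variable {F : FunctorModule R} (hF : PreservesDirectLimits R F)
include hF

theorem PreservesDirectLimits.exists_rep {I : Type u} [Preorder I] [IsDirectedOrder I] [Nonempty I]
    {K : I ⥤ ModuleCat.{u} R} {c : Cocone K} (hc : IsColimit c) (x : F.obj.obj c.pt) :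
    ∃ j, ∃ y : F.obj.obj (K.obj j), F.obj.map (c.ι.app j) y = x := by
  have := hF I
  exact Concrete.isColimit_exists_rep _ (isColimitOfPreserves F.obj hc) x

theorem PreservesDirectLimits.exists_map_eq_zero {I : Type u} [Preorder I] [IsDirectedOrder I]
    [Nonempty I] {K : I ⥤ ModuleCat.{u} R} {c : Cocone K} (hc : IsColimit c) {j : I}
    (y : F.obj.obj (K.obj j)) (h : F.obj.map (c.ι.app j) y = 0) :
    ∃ (k : I) (f : j ⟶ k), F.obj.map (K.map f) y = 0 := by
  have := hF I
  exact QsCh.exists_map_eq_zero (isColimitOfPreserves F.obj hc) y h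

end Criterion

/-! ### Finitely presented modules and direct limits -/

section FinitePresentation

variable {R : Type u} [Ring R]

theorem exists_comp_eq_of_exact {A B C D : Type*} [AddCommGroup A] [Module R A] [AddCommGroup B]
    [Module R B] [AddCommGroup C] [Module R C] [AddCommGroup D] [Module R D] {q : A →ₗ[R] B}
    {p : B →ₗ[R] C} (hp : Function.Surjective p) (hqp : Function.Exact q p) (f : B →ₗ[R] D)
    (hf : f ∘ₗ q = 0) : ∃ g : C →ₗ[R] D, g ∘ₗ p = f := by
  have hker : LinearMap.ker p ≤ LinearMap.ker f := by
    intro x hx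
    obtain ⟨y, rfl⟩ := (hqp x).1 hx
    exact LinearMap.congr_fun hf y
  refine ⟨(LinearMap.ker p).liftQ f hker ∘ₗ (p.quotKerEquivOfSurjective hp).symm.toLinearMap, ?_⟩
  ext x
  have hx : (p.quotKerEquivOfSurjective hp).symm (p x) = Submodule.Quotient.mk x :=
    (LinearEquiv.symm_apply_eq _).2 rfl
  change (LinearMap.ker p).liftQ f hker ((p.quotKerEquivOfSurjective hp).symm (p x)) = f x
  rw [hx]
  rfl

section Factor

variable {I : Type u} [Preorder I] [IsDirectedOrder I] [Nonempty I] {K : I ⥤ ModuleCat.{u} R}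
  {c : Cocone K} (hc : IsColimit c)
include hc

theorem moduleCat_exists_map_eq_zero {j : I} (y : K.obj j) (h : c.ι.app j y = 0) :
    ∃ (k : I) (f : j ⟶ k), K.map f y = 0 := by
  obtain ⟨k, f, g, hfg⟩ := Concrete.isColimit_exists_of_rep_eq K hc y (0 : K.obj j)
    (by rw [h, map_zero])
  exact ⟨k, f, by rw [hfg, map_zero]⟩

theorem exists_map_eq_zero_of_finset {j : I} (s : Finset (K.obj j))
    (h : ∀ y ∈ s, c.ι.app j y = 0) : ∃ (k : I) (f : j ⟶ k), ∀ y ∈ s, K.map f y = 0 := by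
  classical
  induction s using Finset.induction_on with
  | empty => exact ⟨j, 𝟙 j, by simp⟩
  | insert a s _ ih =>
    obtain ⟨k, f, hf⟩ := ih fun y hy => h y (Finset.mem_insert_of_mem hy)
    obtain ⟨l, g, hg⟩ := moduleCat_exists_map_eq_zero hc a (h a (Finset.mem_insert_self a s))
    obtain ⟨m, hkm, hlm⟩ := exists_ge_ge k l
    refine ⟨m, f ≫ homOfLE hkm, fun y hy => ?_⟩
    obtain rfl | hy := Finset.mem_insert.1 hy
    · rw [Subsingleton.elim (f ≫ homOfLE hkm) (g ≫ homOfLE hlm), K.map_comp]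
      simp [hg]
    · rw [K.map_comp]
      simp [hf y hy]

theorem exists_comp_map_eq_zero (A : ModuleCat.{u} R) [Module.Finite R A] {j : I}
    (f : A ⟶ K.obj j) (h : f ≫ c.ι.app j = 0) : ∃ (k : I) (g : j ⟶ k), f ≫ K.map g = 0 := by
  classical
  obtain ⟨s, hs⟩ := Module.Finite.fg_top (R := R) (M := A)
  obtain ⟨k, g, hg⟩ := exists_map_eq_zero_of_finset hc (s.image f) (by
    intro y hy
    obtain ⟨a, _, rfl⟩ := Finset.mem_image.1 hy
    exact ConcreteCategory.congr_hom h a)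
  refine ⟨k, g, ModuleCat.hom_ext (LinearMap.ext_on hs fun a ha => ?_)⟩
  exact hg (f a) (Finset.mem_image_of_mem _ ha)

theorem exists_lift_of_free {n : ℕ} (f : (Fin n → R) →ₗ[R] c.pt) :
    ∃ (j : I) (g : (Fin n → R) →ₗ[R] K.obj j), (c.ι.app j).hom ∘ₗ g = f := by
  have h : ∀ i : Fin n, ∃ j, ∃ y : K.obj j, c.ι.app j y = f (Pi.single i 1) :=
    fun i => Concrete.isColimit_exists_rep K hc _
  choose j y hy using h
  obtain ⟨k, hk⟩ := Finite.exists_le j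
  refine ⟨k, (Pi.basisFun R (Fin n)).constr ℤ fun i => K.map (homOfLE (hk i)) (y i), ?_⟩
  refine (Pi.basisFun R (Fin n)).ext fun i => ?_
  rw [LinearMap.comp_apply, Module.Basis.constr_basis, Pi.basisFun_apply, ← hy]
  exact ConcreteCategory.congr_hom (c.w (homOfLE (hk i))) (y i)

/-- A finite free cover lifts to some stage, and its finitely many relations die at a later one. -/
theorem exists_factor (A : ModuleCat.{u} R) [Module.FinitePresentation R A] (f : A ⟶ c.pt) :
    ∃ (j : I) (g : A ⟶ K.obj j), g ≫ c.ι.app j = f := by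
  obtain ⟨n, m, p, q, hp, hqp⟩ := Module.FinitePresentation.exists_fin' R A
  obtain ⟨j, g, hg⟩ := exists_lift_of_free hc (f.hom ∘ₗ p)
  obtain ⟨k, l, hl⟩ := exists_comp_map_eq_zero hc (ModuleCat.of R (Fin m → R))
    (ModuleCat.ofHom (g ∘ₗ q)) (by
      ext1
      change ((c.ι.app j).hom ∘ₗ g) ∘ₗ q = 0
      rw [hg, LinearMap.comp_assoc, hqp.linearMap_comp_eq_zero, LinearMap.comp_zero])
  obtain ⟨f', hf'⟩ := exists_comp_eq_of_exact hp hqp ((K.map l).hom ∘ₗ g)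
    (congrArg ModuleCat.Hom.hom hl)
  refine ⟨k, ModuleCat.ofHom f', ?_⟩
  ext a
  obtain ⟨x, rfl⟩ := hp a
  refine (congrArg (c.ι.app k) (LinearMap.congr_fun hf' x)).trans ?_
  refine (ConcreteCategory.congr_hom (c.w l) (g x)).trans ?_
  exact LinearMap.congr_fun hg x

end Factor

theorem range_lmapDomain_mono {S : Type*} {s t : Finset S} (h : s ⊆ t) :
    LinearMap.range (Finsupp.lmapDomain R R (Subtype.val : s → S)) ≤
      LinearMap.range (Finsupp.lmapDomain R R (Subtype.val : t → S)) := by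
  rintro _ ⟨x, rfl⟩
  exact ⟨Finsupp.lmapDomain R R (fun a : s => (⟨a.1, h a.2⟩ : t)) x,
    Finsupp.mapDomain_comp.symm⟩

section Presentation

variable (S : Type u) [AddCommGroup S] [Module R S]

/-- Finitely many generators of `S` together with finitely many relations between them. -/
structure FiniteDatum where
  /-- The generators. -/
  gens : Finset S
  /-- The relations. -/
  rels : Submodule R (S →₀ R)
  fg : rels.FG
  le_range : rels ≤ LinearMap.range (Finsupp.lmapDomain R R (Subtype.val : gens → S))
  le_ker : rels ≤ LinearMap.ker (Finsupp.linearCombination R (id : S → S))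

namespace FiniteDatum

instance : PartialOrder (FiniteDatum (R := R) S) :=
  PartialOrder.lift (fun d => (d.gens, d.rels)) fun d d' h => by
    cases d; cases d'; simp_all

instance : Nonempty (FiniteDatum (R := R) S) := ⟨⟨∅, ⊥, Submodule.fg_bot, bot_le, bot_le⟩⟩

variable {S}

-- Relations live in the free module on all of `S`, so two data are joined by a union and a
-- supremum, without transport.
open Classical in
instance : IsDirectedOrder (FiniteDatum (R := R) S) where
  directed d d' :=
    ⟨⟨d.gens ∪ d'.gens, d.rels ⊔ d'.rels, d.fg.sup d'.fg,
      sup_le (d.le_range.trans (range_lmapDomain_mono Finset.subset_union_left))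
        (d'.le_range.trans (range_lmapDomain_mono Finset.subset_union_right)),
      sup_le d.le_ker d'.le_ker⟩,
      ⟨Finset.subset_union_left, le_sup_left⟩, ⟨Finset.subset_union_right, le_sup_right⟩⟩

/-- The module presented by the generators and relations. -/
abbrev Presented (d : FiniteDatum (R := R) S) : Type u :=
  (d.gens →₀ R) ⧸ d.rels.comap (Finsupp.lmapDomain R R (Subtype.val : d.gens → S))

theorem finitePresentation (d : FiniteDatum (R := R) S) :
    Module.FinitePresentation R d.Presented := by
  refine Module.finitePresentation_of_surjective (Submodule.mkQ _)
    (Submodule.mkQ_surjective _) ?_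
  rw [Submodule.ker_mkQ]
  -- By `le_range`, the image of the kernel in the free module on `S` is all of `rels`.
  refine Submodule.fg_of_fg_map_injective (Finsupp.lmapDomain R R (Subtype.val : d.gens → S))
    (Finsupp.mapDomain_injective Subtype.val_injective) ?_
  rw [Submodule.map_comap_eq, inf_eq_right.2 d.le_range]
  exact d.fg

/-- The transition map between presented modules. -/
def transition {d d' : FiniteDatum (R := R) S} (h : d ≤ d') : d.Presented →ₗ[R] d'.Presented :=
  Submodule.mapQ _ _ (Finsupp.lmapDomain R R (fun a : d.gens => (⟨a.1, h.1 a.2⟩ : d'.gens)))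
    fun x hx => by
      refine h.2 ?_
      rw [Finsupp.lmapDomain_apply, Finsupp.lmapDomain_apply, ← Finsupp.mapDomain_comp]
      exact hx

/-- The map from the presented module to `S`. -/
def toModule (d : FiniteDatum (R := R) S) : d.Presented →ₗ[R] S :=
  Submodule.liftQ _ (Finsupp.linearCombination R (Subtype.val : d.gens → S)) fun x hx => by
    have h := d.le_ker hx
    rwa [LinearMap.mem_ker, Finsupp.lmapDomain_apply, Finsupp.linearCombination_mapDomain] at h

variable (R S) in
/-- The diagram of the modules presented by finite data. -/
def diagram : FiniteDatum (R := R) S ⥤ ModuleCat.{u} R where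
  obj d := ModuleCat.of R d.Presented
  map f := ModuleCat.ofHom (transition f.le)
  map_id d := by
    ext1
    refine Submodule.linearMap_qext _ (Finsupp.lhom_ext fun a r => ?_)
    exact congrArg Submodule.Quotient.mk Finsupp.mapDomain_single
  map_comp f g := by
    ext1
    refine Submodule.linearMap_qext _ (Finsupp.lhom_ext fun a r => ?_)
    refine congrArg Submodule.Quotient.mk ?_
    simp

variable (R S) in
/-- The cocone of the modules presented by finite data, with point `S`. -/
def cocone : Cocone (diagram R S) where
  pt := ModuleCat.of R S
  ι :=
    { app d := ModuleCat.ofHom d.toModule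
      naturality d d' f := by
        ext1
        refine Submodule.linearMap_qext _ (Finsupp.lhom_ext fun a r => ?_)
        change Finsupp.linearCombination R _ (Finsupp.mapDomain _ (Finsupp.single a r)) =
          Finsupp.linearCombination R _ (Finsupp.single a r)
        simp }

variable (R S) in
-- Any element can serve as a generator, and a combination of generators that vanishes in `S` can be
-- adjoined as a relation.
theorem nonempty_isColimit_cocone : Nonempty (IsColimit (cocone R S)) := by
  classical
  refine nonempty_isColimit_moduleCat _ _ (fun s => ?_) fun d y hy => ?_
  · let s' : S := s
    refine ⟨⟨{s'}, ⊥, Submodule.fg_bot, bot_le, bot_le⟩,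
      Submodule.Quotient.mk (Finsupp.single ⟨s', by simp⟩ 1), ?_⟩
    change Finsupp.linearCombination R _ (Finsupp.single _ 1) = s'
    simp
  · obtain ⟨x, rfl⟩ := Submodule.Quotient.mk_surjective _ y
    have hx : Finsupp.linearCombination R (Subtype.val : d.gens → S) x = 0 := hy
    set x' := Finsupp.lmapDomain R R (Subtype.val : d.gens → S) x with hx'
    let d' : FiniteDatum (R := R) S :=
      ⟨d.gens, d.rels ⊔ Submodule.span R {x'}, d.fg.sup (Submodule.fg_span_singleton _),
        sup_le d.le_range ((Submodule.span_singleton_le_iff_mem _ _).2 ⟨x, rfl⟩),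
        sup_le d.le_ker ((Submodule.span_singleton_le_iff_mem _ _).2 (by
          rw [LinearMap.mem_ker, hx', Finsupp.lmapDomain_apply,
            Finsupp.linearCombination_mapDomain]
          exact hx))⟩
    refine ⟨d', homOfLE ⟨le_rfl, le_sup_left⟩, ?_⟩
    refine (Submodule.Quotient.mk_eq_zero _).2 ?_
    have h : Finsupp.mapDomain (fun a : d.gens => (⟨a.1, a.2⟩ : d'.gens)) x = x :=
      Finsupp.mapDomain_id
    exact (le_sup_right : _ ≤ d.rels ⊔ Submodule.span R {x'})
      ((congrArg (Finsupp.lmapDomain R R (Subtype.val : d.gens → S)) h).symm ▸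
        Submodule.mem_span_singleton_self _)

end FiniteDatum

end Presentation

variable {F : FunctorModule R} (hF : PreservesDirectLimits R F)
include hF

theorem PreservesDirectLimits.exists_factor_map_eq_zero {I : Type u} [Preorder I]
    [IsDirectedOrder I] [Nonempty I] {K : I ⥤ ModuleCat.{u} R} {c : Cocone K} (hc : IsColimit c)
    {A : ModuleCat.{u} R} [Module.FinitePresentation R A] (a : A ⟶ c.pt) (y : F.obj.obj A)
    (h : F.obj.map a y = 0) :
    ∃ (j : I) (g : A ⟶ K.obj j), g ≫ c.ι.app j = a ∧ F.obj.map g y = 0 := by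
  obtain ⟨j, g, rfl⟩ := exists_factor hc A a
  obtain ⟨k, f, hf⟩ := hF.exists_map_eq_zero hc (F.obj.map g y)
    ((ConcreteCategory.congr_hom (F.obj.map_comp g (c.ι.app j)) y).symm.trans h)
  refine ⟨k, g ≫ K.map f, ?_, (ConcreteCategory.congr_hom (F.obj.map_comp g (K.map f)) y).trans hf⟩
  rw [Category.assoc, c.w]

theorem PreservesDirectLimits.exists_finitePresentation_rep {S : ModuleCat.{u} R}
    (x : F.obj.obj S) : ∃ (A : ModuleCat.{u} R) (_ : Module.FinitePresentation R A) (a : A ⟶ S)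
      (y : F.obj.obj A), F.obj.map a y = x := by
  obtain ⟨hc⟩ := FiniteDatum.nonempty_isColimit_cocone R S
  obtain ⟨d, y, hy⟩ := hF.exists_rep hc x
  exact ⟨_, d.finitePresentation, _, y, hy⟩

theorem PreservesDirectLimits.exists_finitePresentation_map_eq_zero {S A : ModuleCat.{u} R}
    [Module.FinitePresentation R A] (a : A ⟶ S) (y : F.obj.obj A) (h : F.obj.map a y = 0) :
    ∃ (B : ModuleCat.{u} R) (_ : Module.FinitePresentation R B) (f : A ⟶ B) (b : B ⟶ S),
      f ≫ b = a ∧ F.obj.map f y = 0 := by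
  obtain ⟨hc⟩ := FiniteDatum.nonempty_isColimit_cocone R S
  obtain ⟨d, g, hg, hy⟩ := hF.exists_factor_map_eq_zero hc a y h
  exact ⟨_, d.finitePresentation, g, _, hg, hy⟩

end FinitePresentation

variable {R : Type u} [Ring R]

instance (F : FunctorModule R) : F.obj.Additive := F.property

theorem map_comp_apply (F : FunctorModule R) {A B C : ModuleCat.{u} R} (f : A ⟶ B) (g : B ⟶ C)
    (x : F.obj.obj A) : F.obj.map (f ≫ g) x = F.obj.map g (F.obj.map f x) :=
  ConcreteCategory.congr_hom (F.obj.map_comp f g) x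

theorem map_id_apply (F : FunctorModule R) {A : ModuleCat.{u} R}
    (x : F.obj.obj A) : F.obj.map (𝟙 A) x = x :=
  ConcreteCategory.congr_hom (F.obj.map_id A) x

theorem map_add_apply (F : FunctorModule R) {A B : ModuleCat.{u} R} (f g : A ⟶ B)
    (x : F.obj.obj A) : F.obj.map (f + g) x = F.obj.map f x + F.obj.map g x :=
  ConcreteCategory.congr_hom (F.obj.map_add (f := f) (g := g)) x

theorem map_zero_apply (F : FunctorModule R) {A B : ModuleCat.{u} R}
    (x : F.obj.obj A) : F.obj.map (0 : A ⟶ B) x = 0 :=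
  ConcreteCategory.congr_hom (F.obj.map_zero A B) x

theorem map_sub_apply (F : FunctorModule R) {A B : ModuleCat.{u} R} (f g : A ⟶ B)
    (x : F.obj.obj A) : F.obj.map (f - g) x = F.obj.map f x - F.obj.map g x :=
  ConcreteCategory.congr_hom (F.obj.map_sub (f := f) (g := g)) x

theorem map_sum_apply (F : FunctorModule R) {A B : ModuleCat.{u} R} {ι : Type*} (s : Finset ι)
    (f : ι → (A ⟶ B)) (x : F.obj.obj A) :
    F.obj.map (∑ i ∈ s, f i) x = ∑ i ∈ s, F.obj.map (f i) x :=
  map_sum (AddMonoidHom.mk' (fun f : A ⟶ B => F.obj.map f x) fun f g => map_add_apply F f g x) f s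

theorem naturality_apply {F G : FunctorModule R} (f : F.obj ⟶ G.obj) {A B : ModuleCat.{u} R}
    (a : A ⟶ B) (x : F.obj.obj A) : f.app B (F.obj.map a x) = G.obj.map a (f.app A x) :=
  ConcreteCategory.congr_hom (f.naturality a) x

/-! ### Subfunctors of corepresentable functors -/

section Factoring

variable {B C : ModuleCat.{u} R} (g : B ⟶ C)

/-- The functor sending `S` to the group of morphisms `B ⟶ S` which factor through `g`. -/
def factoringFunctor : ModuleCat.{u} R ⥤ AddCommGrpCat.{u} where
  obj S := AddCommGrpCat.of (Preadditive.leftComp S g).range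
  map {S S'} f := AddCommGrpCat.ofHom
    (((Preadditive.rightComp B f).comp (Preadditive.leftComp S g).range.subtype).codRestrict
      (Preadditive.leftComp S' g).range (by
        rintro ⟨_, h, rfl⟩
        exact ⟨h ≫ f, (Category.assoc g h f).symm⟩))
  map_id S := by
    refine AddCommGrpCat.hom_ext (AddMonoidHom.ext fun x => ?_)
    exact Subtype.ext (Category.comp_id x.1)
  map_comp f f' := by
    refine AddCommGrpCat.hom_ext (AddMonoidHom.ext fun x => ?_)
    exact Subtype.ext (Category.assoc x.1 f f').symm

instance : (factoringFunctor g).Additive where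
  map_add {_ _ f f'} := by
    ext x
    exact Subtype.ext (Preadditive.comp_add _ _ _ x.1 f f')

/-- The `𝓡`-module sending `S` to the group of morphisms `B ⟶ S` which factor through `g`. -/
def factoring : FunctorModule R := AdditiveFunctor.of (factoringFunctor g)

/-- The element of `factoring g` at `S` given by `h : C ⟶ S`. -/
def factoringMk {S : ModuleCat.{u} R} (h : C ⟶ S) : (factoring g).obj.obj S :=
  (⟨g ≫ h, h, rfl⟩ : (Preadditive.leftComp S g).range)

variable {g} in
theorem factoringMk_surjective {S : ModuleCat.{u} R} (x : (factoring g).obj.obj S) :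
    ∃ h : C ⟶ S, factoringMk g h = x := by
  obtain ⟨_, h, rfl⟩ := x
  exact ⟨h, rfl⟩

theorem factoring_map_mk {S S' : ModuleCat.{u} R} (h : C ⟶ S) (f : S ⟶ S') :
    (factoring g).obj.map f (factoringMk g h) = factoringMk g (h ≫ f) :=
  Subtype.ext (Category.assoc g h f)

theorem factoringMk_eq_iff {S : ModuleCat.{u} R} (h h' : C ⟶ S) :
    factoringMk g h = factoringMk g h' ↔ g ≫ h = g ≫ h' :=
  Subtype.ext_iff

theorem factoringMk_add {S : ModuleCat.{u} R} (h h' : C ⟶ S) :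
    factoringMk g (h + h') = factoringMk g h + factoringMk g h' :=
  Subtype.ext (Preadditive.comp_add _ _ _ g h h')

theorem factoringMk_eq_zero_iff {S : ModuleCat.{u} R} (h : C ⟶ S) :
    factoringMk g h = 0 ↔ g ≫ h = 0 :=
  Subtype.ext_iff

theorem factoring_preservesDirectLimits [Module.Finite R B] [Module.FinitePresentation R C] :
    PreservesDirectLimits R (factoring g) := by
  refine preservesDirectLimits_of_elementwise _ fun I _ _ _ K c hc => ⟨fun x => ?_, fun j y h => ?_⟩
  · obtain ⟨h, rfl⟩ := factoringMk_surjective x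
    obtain ⟨j, h', rfl⟩ := exists_factor hc C h
    exact ⟨j, factoringMk g h', factoring_map_mk _ _ _⟩
  · obtain ⟨h', rfl⟩ := factoringMk_surjective y
    rw [factoring_map_mk, factoringMk_eq_zero_iff, ← Category.assoc] at h
    obtain ⟨k, f, hf⟩ := exists_comp_map_eq_zero hc B _ h
    refine ⟨k, f, ?_⟩
    rw [factoring_map_mk, factoringMk_eq_zero_iff, ← Category.assoc, hf]

/-- The natural transformation out of `factoring g` given by an element of `F(C)`. -/
def factoringDesc (F : FunctorModule R) (x : F.obj.obj C)
    (hx : ∀ (S : ModuleCat.{u} R) (f : C ⟶ S), g ≫ f = 0 → F.obj.map f x = 0) :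
    (factoring g).obj ⟶ F.obj where
  app S := AddCommGrpCat.ofHom
    -- The chosen extension does not matter: two choices differ by some `f` with `g ≫ f = 0`, and
    -- `hx` applies.
    { toFun y := F.obj.map (factoringMk_surjective y).choose x
      map_zero' := hx _ _ ((factoringMk_eq_zero_iff g _).1 (factoringMk_surjective _).choose_spec)
      map_add' y z := by
        rw [← map_add_apply, ← sub_eq_zero, ← map_sub_apply]
        refine hx _ _ ?_
        rw [Preadditive.comp_sub, sub_eq_zero, ← factoringMk_eq_iff, factoringMk_add,
          (factoringMk_surjective (y + z)).choose_spec, (factoringMk_surjective y).choose_spec,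
          (factoringMk_surjective z).choose_spec]
        rfl }
  naturality S S' f := by
    ext y
    change F.obj.map _ x = F.obj.map f (F.obj.map _ x)
    rw [← map_comp_apply, ← sub_eq_zero, ← map_sub_apply]
    refine hx _ _ ?_
    rw [Preadditive.comp_sub, sub_eq_zero, ← factoringMk_eq_iff, ← factoring_map_mk,
      (factoringMk_surjective _).choose_spec, (factoringMk_surjective y).choose_spec]
    rfl

theorem factoringDesc_mk (F : FunctorModule R) (x : F.obj.obj C)
    (hx : ∀ (S : ModuleCat.{u} R) (f : C ⟶ S), g ≫ f = 0 → F.obj.map f x = 0)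
    {S : ModuleCat.{u} R} (h : C ⟶ S) :
    (factoringDesc g F x hx).app S (factoringMk g h) = F.obj.map h x := by
  change F.obj.map _ x = _
  rw [← sub_eq_zero, ← map_sub_apply]
  refine hx _ _ ?_
  rw [Preadditive.comp_sub, sub_eq_zero, ← factoringMk_eq_iff,
    (factoringMk_surjective _).choose_spec]

end Factoring

/-! ### Monomorphisms and right exactness -/

section Mono

theorem mono_of_injective {X Y : DirectLimitFunctor R} (f : X ⟶ Y)
    (h : ∀ S, Function.Injective (f.hom.hom.app S)) : Mono f where
  right_cancellation {Z} a b hab := by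
    ext S x
    refine h S ?_
    exact ConcreteCategory.congr_hom (congrArg (fun t => t.hom.hom.app S) hab) x

/-- Hom(B, -) with `B` finitely presented lies in the subcategory, so by Yoneda a monomorphism is
injective at `B`; a kernel element at `S` comes from one at such a `B`. -/
theorem injective_of_mono {X Y : DirectLimitFunctor R} (f : X ⟶ Y) [Mono f]
    (S : ModuleCat.{u} R) : Function.Injective (f.hom.hom.app S) := by
  rw [injective_iff_map_eq_zero]
  intro x hx
  obtain ⟨A, _, a, y, rfl⟩ := X.property.exists_finitePresentation_rep x
  rw [naturality_apply] at hx
  obtain ⟨B, _, b, b', rfl, hy⟩ := Y.property.exists_finitePresentation_map_eq_zero a _ hx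
  rw [← naturality_apply] at hy
  suffices X.obj.obj.map b y = 0 by rw [map_comp_apply, this, map_zero]
  let Z : DirectLimitFunctor R := ⟨factoring (𝟙 B), factoring_preservesDirectLimits _⟩
  have hx : ∀ (x : X.obj.obj.obj B) (S : ModuleCat.{u} R) (f : B ⟶ S), 𝟙 B ≫ f = 0 →
      X.obj.obj.map f x = 0 := by
    intro x S f hf
    rw [← Category.id_comp f, hf, map_zero_apply]
  let t (x : X.obj.obj.obj B) : Z ⟶ X := ⟨⟨factoringDesc (𝟙 B) X.obj x (hx x)⟩⟩
  have htapp : ∀ x T (h : B ⟶ T),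
      (t x).hom.hom.app T (factoringMk (𝟙 B) h) = X.obj.obj.map h x :=
    fun x T h => factoringDesc_mk (𝟙 B) X.obj x (hx x) h
  have ht : t (X.obj.obj.map b y) = t 0 := by
    rw [← cancel_mono f]
    ext T z
    obtain ⟨h, rfl⟩ := factoringMk_surjective z
    change f.hom.hom.app T ((t _).hom.hom.app T _) = f.hom.hom.app T ((t _).hom.hom.app T _)
    rw [htapp, htapp, naturality_apply, hy, map_zero, map_zero, map_zero]
  have h := htapp (X.obj.obj.map b y) B (𝟙 B)
  rwa [ht, htapp, map_id_apply, map_id_apply, eq_comm] at h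

end Mono

/-- A functor module is right exact on finitely presented modules if an element of `F(C)` lifts
along `g : B ⟶ C` as soon as it is killed by all morphisms killing `g`. -/
def RightExactOnFP (F : FunctorModule R) : Prop :=
  ∀ ⦃B C : ModuleCat.{u} R⦄ [Module.FinitePresentation R B] [Module.FinitePresentation R C]
    (g : B ⟶ C) (x : F.obj.obj C),
    (∀ (S : ModuleCat.{u} R) (f : C ⟶ S), g ≫ f = 0 → F.obj.map f x = 0) →
    ∃ z, F.obj.map g z = x

/-- The element `x` defines a transformation on the subfunctor `factoring g` of Hom(B, -). Its
extension to Hom(B, -) is, by Yoneda, an element of the value at `B`, and this is the required lift.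
-/
theorem rightExactOnFP_of_injective (X : DirectLimitFunctor R) [Injective X] :
    RightExactOnFP X.obj := by
  intro B C _ _ g x hx
  let Y : DirectLimitFunctor R := ⟨factoring g, factoring_preservesDirectLimits _⟩
  let Z : DirectLimitFunctor R := ⟨factoring (𝟙 B), factoring_preservesDirectLimits _⟩
  let s : Y ⟶ X := ⟨⟨factoringDesc g X.obj x hx⟩⟩
  have hg : ∀ (S : ModuleCat.{u} R) (f : C ⟶ S), g ≫ f = 0 →
      (factoring (𝟙 B)).obj.map f (factoringMk (𝟙 B) g) = 0 := by
    intro S f hf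
    rw [factoring_map_mk, hf, factoringMk_eq_zero_iff, comp_zero]
  let i : Y ⟶ Z := ⟨⟨factoringDesc g (factoring (𝟙 B)) (factoringMk (𝟙 B) g) hg⟩⟩
  have hi : ∀ S (f : C ⟶ S), i.hom.hom.app S (factoringMk g f) = factoringMk (𝟙 B) (g ≫ f) :=
    fun S f => (factoringDesc_mk g (factoring (𝟙 B)) _ hg f).trans (factoring_map_mk _ _ _)
  have : Mono i := mono_of_injective i fun S a b hab => by
    obtain ⟨f, rfl⟩ := factoringMk_surjective a
    obtain ⟨f', rfl⟩ := factoringMk_surjective b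
    rw [hi, hi, factoringMk_eq_iff, Category.id_comp, Category.id_comp] at hab
    exact (factoringMk_eq_iff g _ _).2 hab
  let t : Z ⟶ X := Injective.factorThru s i
  have ht : i ≫ t = s := Injective.comp_factorThru s i
  refine ⟨t.hom.hom.app B (factoringMk (𝟙 B) (𝟙 B)), ?_⟩
  rw [← naturality_apply, factoring_map_mk, Category.id_comp]
  have h := ConcreteCategory.congr_hom (congrArg (fun t => t.hom.hom.app C) ht)
    (factoringMk g (𝟙 C))
  change t.hom.hom.app C (i.hom.hom.app C _) = (factoringDesc g X.obj x hx).app C _ at h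
  rwa [hi, factoringDesc_mk, map_id_apply, Category.comp_id] at h

/-! ### Tensor products and the Hom-tensor adjunction -/

section TensorLift

variable {M : Type u} [AddCommGroup M] [Module Rᵐᵒᵖ M] {S : Type u} [AddCommGroup S] [Module R S]

@[elab_as_elim]
theorem rtensor_induction {motive : RTensor R M S → Prop} (zero : motive 0)
    (tmul : ∀ m s, motive (rtmul R m s)) (add : ∀ x y, motive x → motive y → motive (x + y))
    (t : RTensor R M S) : motive t := by
  obtain ⟨t, rfl⟩ := Submodule.Quotient.mk_surjective _ t
  induction t with
  | zero => exact zero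
  | tmul m s => exact tmul m s
  | add x y hx hy => exact add _ _ hx hy

theorem rtmul_add (m : M) (s s' : S) : rtmul R m (s + s') = rtmul R m s + rtmul R m s' :=
  congrArg Submodule.Quotient.mk (TensorProduct.tmul_add m s s')

theorem add_rtmul (m m' : M) (s : S) : rtmul R (m + m') s = rtmul R m s + rtmul R m' s :=
  congrArg Submodule.Quotient.mk (TensorProduct.add_tmul m m' s)

theorem smul_rtmul (r : R) (m : M) (s : S) : rtmul R (op r • m) s = rtmul R m (r • s) :=
  (Submodule.Quotient.eq _).2 (Submodule.subset_span ⟨m, r, s, rfl⟩)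

variable (R) in
/-- The pure tensor as a biadditive map. -/
def rtmulHom : M →+ S →+ RTensor R M S :=
  AddMonoidHom.mk' (fun m => AddMonoidHom.mk' (rtmul R m) (rtmul_add (R := R) m)) fun m m' =>
    AddMonoidHom.ext fun s => add_rtmul (R := R) m m' s

/-- The homomorphism out of the tensor product given by a balanced biadditive map. -/
def rtlift {A : Type*} [AddCommGroup A] (f : M →+ S →+ A)
    (hf : ∀ (r : R) m s, f (op r • m) s = f m (r • s)) : RTensor R M S →+ A :=
  ((balancedRel R M S).liftQ
    (TensorProduct.liftAddHom f fun r m s => by simp).toIntLinearMap (by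
      refine Submodule.span_le.2 ?_
      rintro _ ⟨m, r, s, rfl⟩
      rw [SetLike.mem_coe, LinearMap.mem_ker, AddMonoidHom.coe_toIntLinearMap, map_sub,
        TensorProduct.liftAddHom_tmul, TensorProduct.liftAddHom_tmul, hf, sub_self])).toAddMonoidHom

theorem rtensor_addHom_ext {A : Type*} [AddCommGroup A] {φ ψ : RTensor R M S →+ A}
    (h : ∀ m s, φ (rtmul R m s) = ψ (rtmul R m s)) : φ = ψ := by
  ext t
  induction t using rtensor_induction with
  | zero => rw [map_zero, map_zero]
  | tmul m s => exact h m s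
  | add x y hx hy => rw [map_add, map_add, hx, hy]

end TensorLift

section CoHom

universe v

/-- The left `R`-module of additive maps from a right `R`-module to an abelian group. -/
def CoHom (M : Type u) (Z : Type v) [AddCommGroup M] [AddCommGroup Z] := M →+ Z

variable {M : Type u} [AddCommGroup M] [Module Rᵐᵒᵖ M] {Z : Type v} [AddCommGroup Z]

instance : AddCommGroup (CoHom M Z) := inferInstanceAs (AddCommGroup (M →+ Z))

instance : FunLike (CoHom M Z) M Z := inferInstanceAs (FunLike (M →+ Z) M Z)

instance : AddMonoidHomClass (CoHom M Z) M Z :=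
  inferInstanceAs (AddMonoidHomClass (M →+ Z) M Z)

theorem CoHom.ext {f g : CoHom M Z} (h : ∀ m, f m = g m) : f = g := DFunLike.ext f g h

instance : SMul R (CoHom M Z) where
  smul r f := AddMonoidHom.mk' (fun m => f (op r • m)) fun m m' => by rw [smul_add, map_add]

instance : Module R (CoHom M Z) where
  one_smul f := CoHom.ext fun m => congrArg f (one_smul Rᵐᵒᵖ m)
  mul_smul r s f := CoHom.ext fun m => congrArg f (mul_smul (op s) (op r) m)
  smul_zero r := rfl
  smul_add r f g := rfl
  add_smul r s f := CoHom.ext fun m =>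
    (congrArg f (add_smul (op r) (op s) m)).trans (map_add f _ _)
  zero_smul f := CoHom.ext fun m => (congrArg f (zero_smul Rᵐᵒᵖ m)).trans (map_zero f)

/-- Linear maps `S → Hom(M, Z)` are additive maps `M ⊗_R S → Z`. -/
def rtensorHomEquiv {S : Type u} [AddCommGroup S] [Module R S] :
    (RTensor R M S →+ Z) ≃ (S →ₗ[R] CoHom M Z) where
  toFun φ :=
    { toFun s := φ.comp ((rtmulHom R).flip s)
      map_add' s s' := CoHom.ext fun m =>
        (congrArg φ (rtmul_add m s s')).trans (map_add φ _ _)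
      map_smul' r s := CoHom.ext fun m => congrArg φ (smul_rtmul r m s).symm }
  invFun ψ := rtlift (R := R) (M := M) (S := S)
    (AddMonoidHom.mk' (fun m => AddMonoidHom.mk' (fun s => ψ s m)
      fun s s' => DFunLike.congr_fun (map_add ψ s s') m) fun m m' =>
        AddMonoidHom.ext fun s => map_add (ψ s) m m')
    fun r m s => (DFunLike.congr_fun (map_smul ψ r s) m).symm
  left_inv φ := rtensor_addHom_ext fun m s => rfl
  right_inv ψ := rfl

end CoHom

section Colimits

variable (M : ModuleCat.{u} Rᵐᵒᵖ)

/-- The functor `Z ↦ Hom(M, Z)` from abelian groups to left `R`-modules. -/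
def coHomFunctor : AddCommGrpCat.{u} ⥤ ModuleCat.{u} R where
  obj Z := ModuleCat.of R (CoHom M Z)
  map f := ModuleCat.ofHom
    { toFun g := f.hom.comp (g : M →+ _)
      map_add' g h := CoHom.ext fun m => map_add f.hom (g m) (h m)
      map_smul' r g := rfl }

/-- Tensoring with `M` is left adjoint to `Hom(M, -)`. -/
def quasiCoherentAdjunction : quasiCoherentFunctor M ⊣ coHomFunctor M :=
  Adjunction.mkOfHomEquiv
    { homEquiv S Z :=
        { toFun φ := ModuleCat.ofHom (rtensorHomEquiv φ.hom)
          invFun ψ := AddCommGrpCat.ofHom (rtensorHomEquiv.symm ψ.hom)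
          left_inv φ := AddCommGrpCat.hom_ext (rtensorHomEquiv.symm_apply_apply φ.hom)
          right_inv ψ := ModuleCat.hom_ext (rtensorHomEquiv.apply_symm_apply ψ.hom) }
      homEquiv_naturality_left_symm f g :=
        AddCommGrpCat.hom_ext (rtensor_addHom_ext fun m s => rfl)
      homEquiv_naturality_right f g := rfl }

theorem quasiCoherent_preservesDirectLimits : PreservesDirectLimits R (quasiCoherent M) := by
  intro I _ _ _
  have := (quasiCoherentAdjunction M).leftAdjoint_preservesColimits
  change PreservesColimitsOfShape I (quasiCoherentFunctor M)
  infer_instance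

end Colimits

section QuasiCoherentMap

variable {M N : ModuleCat.{u} Rᵐᵒᵖ}

/-- The natural transformation `M ⊗_R - → N ⊗_R -` given by a morphism `M ⟶ N`. -/
def quasiCoherentMap (f : M ⟶ N) : (quasiCoherent M).obj ⟶ (quasiCoherent N).obj where
  app S := AddCommGrpCat.ofHom (rtmap (R := R) f.hom (LinearMap.id : S →ₗ[R] S)).toAddMonoidHom
  naturality S S' g := AddCommGrpCat.hom_ext (rtensor_addHom_ext fun m s => rfl)

theorem quasiCoherent_hom_ext {X : ModuleCat.{u} R ⥤ AddCommGrpCat.{u}}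
    {φ ψ : (quasiCoherent M).obj ⟶ X}
    (h : ∀ (S : ModuleCat.{u} R) m (s : S), φ.app S (rtmul R m s) = ψ.app S (rtmul R m s)) :
    φ = ψ := by
  ext1
  funext S
  exact AddCommGrpCat.hom_ext (rtensor_addHom_ext (h S))

end QuasiCoherentMap

/-! ### The comparison map F(R) ⊗_R S → F(S) -/

section Comparison

variable (F : FunctorModule R)

/-- The value of a functor module at `R`. -/
abbrev BaseValue : Type u := F.obj.obj (ModuleCat.of R R)

/-- The morphism `R ⟶ S` sending `1` to `s`. -/
abbrev fromOne {S : ModuleCat.{u} R} (s : S) : ModuleCat.of R R ⟶ S :=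
  ModuleCat.ofHom (LinearMap.toSpanSingleton R S s)

theorem fromOne_comp {S S' : ModuleCat.{u} R} (s : S) (f : S ⟶ S') :
    fromOne s ≫ f = fromOne (f s) := by
  ext
  simp

theorem fromOne_add {S : ModuleCat.{u} R} (s s' : S) :
    fromOne (s + s') = fromOne s + fromOne s' := by
  ext
  simp

theorem fromOne_zero {S : ModuleCat.{u} R} : fromOne (0 : S) = 0 := by
  ext
  simp

theorem fromOne_one : fromOne (1 : ModuleCat.of R R) = 𝟙 _ := by
  ext
  simp

theorem fromOne_smul {S : ModuleCat.{u} R} (r : R) (s : S) :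
    fromOne (r • s) = fromOne (S := ModuleCat.of R R) r ≫ fromOne s := by
  ext
  simp

/-- Right multiplication by `r` is an endomorphism of the left module `R`, on which `F` acts. -/
instance : Module Rᵐᵒᵖ (BaseValue F) where
  smul r x := F.obj.map (fromOne (S := ModuleCat.of R R) r.unop) x
  one_smul x := by
    change F.obj.map (fromOne (1 : ModuleCat.of R R)) x = x
    rw [fromOne_one, map_id_apply]
  mul_smul r s x := by
    change F.obj.map (fromOne (S := ModuleCat.of R R) (s.unop • r.unop)) x = _
    rw [fromOne_smul, map_comp_apply]
    rfl
  smul_zero r := map_zero _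
  smul_add r x y := map_add _ _ _
  add_smul r s x := by
    change F.obj.map (fromOne (S := ModuleCat.of R R) (r.unop + s.unop)) x = _
    rw [fromOne_add, map_add_apply]
    rfl
  zero_smul x := by
    change F.obj.map (fromOne (0 : ModuleCat.of R R)) x = _
    rw [fromOne_zero, map_zero_apply]

/-- The value of a functor module at `R`, as a right `R`-module. -/
abbrev baseModule : ModuleCat.{u} Rᵐᵒᵖ := ModuleCat.of Rᵐᵒᵖ (BaseValue F)

/-- The comparison map `F(R) ⊗_R S → F(S)`. -/
def comparisonHom (S : ModuleCat.{u} R) : RTensor R (BaseValue F) S →+ F.obj.obj S :=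
  rtlift (R := R) (M := BaseValue F)
    (AddMonoidHom.mk' (fun m => AddMonoidHom.mk' (fun s : S => F.obj.map (fromOne s) m)
      fun s s' => by rw [fromOne_add, map_add_apply]) fun m m' => by
        ext s
        exact map_add (F.obj.map (fromOne s)).hom m m')
    fun r m s => by
      change F.obj.map (fromOne s) (F.obj.map _ m) = F.obj.map (fromOne (r • s)) m
      rw [fromOne_smul, map_comp_apply]

/-- The natural transformation `F(R) ⊗_R S → F(S)`. -/
def comparison : (quasiCoherent (baseModule F)).obj ⟶ F.obj where
  app S := AddCommGrpCat.ofHom (comparisonHom F S)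
  naturality S S' f := AddCommGrpCat.hom_ext (rtensor_addHom_ext fun m s => by
    change F.obj.map (fromOne (f s)) m = F.obj.map f (F.obj.map (fromOne s) m)
    rw [← fromOne_comp, map_comp_apply])

variable {F}

theorem comparison_bijective_of_free (n : ℕ) :
    Function.Bijective ((comparison F).app (ModuleCat.of R (Fin n → R))) := by
  let P := ModuleCat.of R (Fin n → R)
  let pr (i : Fin n) : P ⟶ ModuleCat.of R R := ModuleCat.ofHom (LinearMap.proj i)
  let e (i : Fin n) : P := (Pi.single i 1 : Fin n → R)
  -- The inverse sends x to the sum of the F(pr i)(x) ⊗ e i, as F is additive.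
  let d : F.obj.obj P →+ RTensor R (BaseValue F) P :=
    ∑ i, ((rtmulHom R).flip (e i)).comp (F.obj.map (pr i)).hom
  have hd_apply : ∀ x, d x = ∑ i, rtmul R (F.obj.map (pr i) x : BaseValue F) (e i) := fun x =>
    AddMonoidHom.finsetSum_apply _ _ _
  have hbasis : ∀ y : P, ∑ i, pr i y • e i = y := fun y => by
    have h := (Pi.basisFun R (Fin n)).sum_repr y
    simp only [Pi.basisFun_apply] at h
    exact h
  have hsum : ∀ x : F.obj.obj P, ∑ i, F.obj.map (fromOne (e i)) (F.obj.map (pr i) x) = x := by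
    intro x
    have h : ∑ i, pr i ≫ fromOne (e i) = 𝟙 P := by
      refine ModuleCat.hom_ext (LinearMap.ext fun y => ?_)
      rw [ModuleCat.hom_sum, LinearMap.sum_apply]
      exact hbasis y
    simp_rw [← map_comp_apply]
    rw [← map_sum_apply, h, map_id_apply]
  have hd : d.comp ((comparison F).app P).hom = AddMonoidHom.id _ := by
    refine rtensor_addHom_ext fun m s => ?_
    change d (F.obj.map (fromOne s) m) = rtmul R m s
    have h : ∀ i, F.obj.map (pr i) (F.obj.map (fromOne s) m) = op (pr i s) • m := fun i => by
      rw [← map_comp_apply, fromOne_comp]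
      rfl
    simp_rw [hd_apply, h, smul_rtmul]
    exact (map_sum (rtmulHom R (S := P) m) _ _).symm.trans (congrArg (rtmul R m) (hbasis s))
  refine ⟨Function.LeftInverse.injective (g := d) (DFunLike.congr_fun hd), fun x => ⟨d x, ?_⟩⟩
  rw [hd_apply]
  exact (map_sum ((comparison F).app P).hom _ _).trans (hsum x)

/-- A diagram chase over a presentation R^m → R^n → A → 0, with the free case known. -/
theorem RightExactOnFP.comparison_bijective (hF : RightExactOnFP F) (A : ModuleCat.{u} R)
    [Module.FinitePresentation R A] : Function.Bijective ((comparison F).app A) := by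
  obtain ⟨n, m, p, q, hp, hqp⟩ := Module.FinitePresentation.exists_fin' R A
  let p' : ModuleCat.of R (Fin n → R) ⟶ A := ModuleCat.ofHom p
  let q' : ModuleCat.of R (Fin m → R) ⟶ ModuleCat.of R (Fin n → R) := ModuleCat.ofHom q
  obtain ⟨hn₁, hn₂⟩ := comparison_bijective_of_free (F := F) n
  obtain ⟨_, hm⟩ := comparison_bijective_of_free (F := F) m
  have hqp' : q' ≫ p' = 0 := ModuleCat.hom_ext hqp.linearMap_comp_eq_zero
  constructor
  · rw [injective_iff_map_eq_zero]
    intro t ht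
    obtain ⟨t, rfl⟩ : ∃ t', (quasiCoherent (baseModule F)).obj.map p' t' = t := by
      refine rtensor_induction ⟨0, map_zero _⟩ (fun m s => ?_) ?_ t
      · obtain ⟨x, rfl⟩ := hp s
        exact ⟨rtmul R m x, rfl⟩
      · rintro _ _ ⟨x, rfl⟩ ⟨y, rfl⟩
        exact ⟨x + y, map_add _ _ _⟩
    rw [naturality_apply] at ht
    -- Morphisms killing `q'` factor through its cokernel `p'`, and `p'` kills the image of `t`.
    obtain ⟨z, hz⟩ := hF q' ((comparison F).app _ t) fun S f hf => by
      obtain ⟨g, rfl⟩ : ∃ g, p' ≫ g = f :=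
        let ⟨g, hg⟩ := exists_comp_eq_of_exact hp hqp f.hom (congrArg ModuleCat.Hom.hom hf)
        ⟨ModuleCat.ofHom g, ModuleCat.hom_ext hg⟩
      rw [map_comp_apply, ht, map_zero]
    obtain ⟨w, rfl⟩ := hm z
    rw [← naturality_apply] at hz
    rw [← hn₁ hz, ← map_comp_apply, hqp', map_zero_apply]
  · intro x
    obtain ⟨y, rfl⟩ := hF p' x fun S f hf => by
      have : f = 0 := by
        ext a
        obtain ⟨y, rfl⟩ := hp a
        exact ConcreteCategory.congr_hom hf y
      rw [this, map_zero_apply]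
    obtain ⟨z, rfl⟩ := hn₂ y
    exact ⟨(quasiCoherent (baseModule F)).obj.map p' z, naturality_apply _ _ _⟩

end Comparison

/-! ### Character functors -/

section Characters

/-- A character of `G` killing the kernel of `g : G → H` extends along `g`. -/
theorem exists_character_comp_eq {G H : Type*} [AddCommGroup G] [AddCommGroup H] (g : G →+ H)
    (χ : G →+ AddCircle (1 : ℚ)) (h : ∀ x, g x = 0 → χ x = 0) :
    ∃ ψ : H →+ AddCircle (1 : ℚ), ψ.comp g = χ := by
  obtain ⟨ψ, hψ⟩ := (Module.Baer.of_divisible (AddCircle (1 : ℚ))).extension_property_addMonoidHom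
    (QuotientAddGroup.kerLift g) (QuotientAddGroup.kerLift_injective g)
    (QuotientAddGroup.lift g.ker χ fun x hx => h x hx)
  refine ⟨ψ, AddMonoidHom.ext fun x => ?_⟩
  exact DFunLike.congr_fun hψ (x : G ⧸ g.ker)

variable (N : ModuleCat.{u} R)

/-- The functor `S ↦ Hom_ℤ(Hom_R(S, N), ℚ/ℤ)`. -/
def characterFunctor : ModuleCat.{u} R ⥤ AddCommGrpCat.{u} where
  obj S := AddCommGrpCat.of ((S ⟶ N) →+ AddCircle (1 : ℚ))
  map f := AddCommGrpCat.ofHom (AddMonoidHom.compHom' (Preadditive.leftComp N f))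
  map_id S := AddCommGrpCat.hom_ext (AddMonoidHom.ext
    fun χ : (S ⟶ N) →+ AddCircle (1 : ℚ) => AddMonoidHom.ext fun u =>
      congrArg χ (Category.id_comp u))
  map_comp {S _ _} f g := AddCommGrpCat.hom_ext (AddMonoidHom.ext
    fun χ : (S ⟶ N) →+ AddCircle (1 : ℚ) => AddMonoidHom.ext fun u =>
      congrArg χ (Category.assoc f g u))

instance : (characterFunctor N).Additive where
  map_add {S _ f g} := AddCommGrpCat.hom_ext (AddMonoidHom.ext
    fun χ : (S ⟶ N) →+ AddCircle (1 : ℚ) => AddMonoidHom.ext fun u =>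
      (congrArg χ (Preadditive.add_comp _ _ _ f g u)).trans (map_add χ (f ≫ u) (g ≫ u)))

/-- The functor module `S ↦ Hom_ℤ(Hom_R(S, N), ℚ/ℤ)`. -/
def characters : FunctorModule R := AdditiveFunctor.of (characterFunctor N)

/-- An element of `characters N` as a homomorphism. -/
def characterHom {S : ModuleCat.{u} R} :
    (characters N).obj.obj S ≃+ ((S ⟶ N) →+ AddCircle (1 : ℚ)) :=
  AddEquiv.refl _

variable {N}

theorem characterHom_map {S S' : ModuleCat.{u} R} (f : S ⟶ S') (χ : (characters N).obj.obj S)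
    (u : S' ⟶ N) : characterHom N ((characters N).obj.map f χ) u = characterHom N χ (f ≫ u) := rfl

theorem characters_ext {S : ModuleCat.{u} R} {χ ψ : (characters N).obj.obj S}
    (h : ∀ u, characterHom N χ u = characterHom N ψ u) : χ = ψ :=
  (characterHom N).injective (AddMonoidHom.ext h)

/-- Evaluating the hypothesis at `𝟙 N` shows that the character kills the kernel of Hom(C, N) →
Hom(B, N); divisibility of ℚ/ℤ then extends it. -/
theorem characters_rightExactOnFP : RightExactOnFP (characters N) := by
  intro B C _ _ g χ hχ
  obtain ⟨ψ, hψ⟩ := exists_character_comp_eq (Preadditive.leftComp N g) (characterHom N χ)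
    fun u hu => by
      have h := DFunLike.congr_fun (congrArg (characterHom N) (hχ N u hu)) (𝟙 N)
      rw [characterHom_map, Category.comp_id, map_zero] at h
      exact h
  exact ⟨(characterHom N).symm ψ, characters_ext fun u => DFunLike.congr_fun hψ u⟩

/-- The natural transformation `F → characters N` given by a character of `F(N)`. -/
def toCharacters {F : FunctorModule R} (χ : F.obj.obj N →+ AddCircle (1 : ℚ)) :
    F.obj ⟶ (characters N).obj where
  app S := AddCommGrpCat.ofHom
    (AddMonoidHom.mk' (fun x => (characterHom N).symm
      (AddMonoidHom.mk' (fun u => χ (F.obj.map u x)) fun u v => by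
        rw [map_add_apply, map_add])) fun x y => characters_ext fun u =>
          (congrArg χ (map_add (F.obj.map u).hom x y)).trans (map_add χ _ _))
  naturality S S' f := AddCommGrpCat.hom_ext (AddMonoidHom.ext fun x => characters_ext fun u =>
    congrArg χ (map_comp_apply F f u x).symm)

/-- Evaluation at `𝟙 N` turns transformations into `characters N` into characters of the value at
`N`, which extend along an injection. -/
theorem exists_comp_eq_of_injective {X Y : FunctorModule R} (f : X.obj ⟶ Y.obj)
    (hf : Function.Injective (f.app N)) (g : X.obj ⟶ (characters N).obj) :
    ∃ h : Y.obj ⟶ (characters N).obj, f ≫ h = g := by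
  obtain ⟨ψ, hψ⟩ := exists_character_comp_eq (f.app N).hom
    (((AddMonoidHom.eval (𝟙 N)).comp (characterHom N).toAddMonoidHom).comp (g.app N).hom)
    fun x hx => by
      have h : x = 0 := hf (hx.trans (map_zero (f.app N).hom).symm)
      rw [h, map_zero]
  refine ⟨toCharacters ψ, ?_⟩
  ext S x
  refine characters_ext fun u => ?_
  change ψ (Y.obj.map u (f.app S x)) = _
  rw [← naturality_apply]
  refine (DFunLike.congr_fun hψ (X.obj.map u x)).trans ?_
  change characterHom N (g.app N (X.obj.map u x)) (𝟙 N) = _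
  rw [naturality_apply, characterHom_map, Category.comp_id]

end Characters

/-! ### Extending transformations from finitely presented modules -/

section Extension

theorem eq_of_comp_eq {X Y T : FunctorModule R} (hX : PreservesDirectLimits R X) (θ : Y.obj ⟶ T.obj)
    (hθ : ∀ (A : ModuleCat.{u} R) [Module.FinitePresentation R A], Function.Injective (θ.app A))
    {a b : X.obj ⟶ Y.obj} (h : a ≫ θ = b ≫ θ) : a = b := by
  ext S x
  obtain ⟨A, _, f, y, rfl⟩ := hX.exists_finitePresentation_rep x
  have hy : a.app A y = b.app A y :=
    hθ A (ConcreteCategory.congr_hom (congrArg (fun t => t.app A) h) y)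
  change a.app S (X.obj.map f y) = b.app S (X.obj.map f y)
  rw [naturality_apply, naturality_apply, hy]

section

variable {X Y T : FunctorModule R} (θ : Y.obj ⟶ T.obj) (η : X.obj ⟶ T.obj)

/-- The relation generated by `θ⁻¹ ∘ η` on finitely presented modules. -/
def LiftRel {S : ModuleCat.{u} R} (x : X.obj.obj S) (y : Y.obj.obj S) : Prop :=
  ∃ (A : ModuleCat.{u} R) (_ : Module.FinitePresentation R A) (a : A ⟶ S) (x' : X.obj.obj A)
    (y' : Y.obj.obj A), X.obj.map a x' = x ∧ Y.obj.map a y' = y ∧ θ.app A y' = η.app A x'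

variable {θ η}

theorem LiftRel.map {S S' : ModuleCat.{u} R} (f : S ⟶ S') {x : X.obj.obj S} {y : Y.obj.obj S}
    (h : LiftRel θ η x y) : LiftRel θ η (X.obj.map f x) (Y.obj.map f y) := by
  obtain ⟨A, hA, a, x', y', rfl, rfl, h⟩ := h
  exact ⟨A, hA, a ≫ f, x', y', map_comp_apply _ _ _ _, map_comp_apply _ _ _ _, h⟩

theorem LiftRel.app_eq {S : ModuleCat.{u} R} {x : X.obj.obj S} {y : Y.obj.obj S}
    (h : LiftRel θ η x y) : θ.app S y = η.app S x := by
  obtain ⟨A, hA, a, x', y', rfl, rfl, h⟩ := h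
  rw [naturality_apply, naturality_apply, h]

theorem LiftRel.add {S : ModuleCat.{u} R} {x₁ x₂ : X.obj.obj S} {y₁ y₂ : Y.obj.obj S}
    (h₁ : LiftRel θ η x₁ y₁) (h₂ : LiftRel θ η x₂ y₂) : LiftRel θ η (x₁ + x₂) (y₁ + y₂) := by
  obtain ⟨A, _, a, x, y, rfl, rfl, h⟩ := h₁
  obtain ⟨B, _, b, x', y', rfl, rfl, h'⟩ := h₂
  -- Both witnesses are moved to the common finitely presented module A × B.
  let P := ModuleCat.of R (A × B)
  let i : A ⟶ P := ModuleCat.ofHom (LinearMap.inl R A B)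
  let j : B ⟶ P := ModuleCat.ofHom (LinearMap.inr R A B)
  let p : P ⟶ S := ModuleCat.ofHom (LinearMap.coprod a.hom b.hom)
  have hi : i ≫ p = a := ModuleCat.hom_ext (LinearMap.coprod_inl a.hom b.hom)
  have hj : j ≫ p = b := ModuleCat.hom_ext (LinearMap.coprod_inr a.hom b.hom)
  refine ⟨P, inferInstanceAs (Module.FinitePresentation R (A × B)), p,
    X.obj.map i x + X.obj.map j x', Y.obj.map i y + Y.obj.map j y', ?_, ?_, ?_⟩
  · rw [map_add, ← map_comp_apply, ← map_comp_apply, hi, hj]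
  · rw [map_add, ← map_comp_apply, ← map_comp_apply, hi, hj]
  · rw [map_add, map_add, naturality_apply, naturality_apply, naturality_apply, naturality_apply,
      h, h']

theorem LiftRel.neg {S : ModuleCat.{u} R} {x : X.obj.obj S} {y : Y.obj.obj S}
    (h : LiftRel θ η x y) : LiftRel θ η (-x) (-y) := by
  obtain ⟨A, hA, a, x', y', rfl, rfl, h⟩ := h
  exact ⟨A, hA, a, -x', -y', map_neg _ _, map_neg _ _, by rw [map_neg, map_neg, h]⟩

/-- The witness in `X` already dies at a finitely presented stage, where injectivity of `θ` kills
its partner. With additivity this makes the relation single-valued. -/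
theorem LiftRel.eq_zero (hX : PreservesDirectLimits R X)
    (hθ : ∀ (A : ModuleCat.{u} R) [Module.FinitePresentation R A], Function.Injective (θ.app A))
    {S : ModuleCat.{u} R} {y : Y.obj.obj S} (h : LiftRel θ η 0 y) : y = 0 := by
  obtain ⟨A, _, a, x', y', hx, rfl, h⟩ := h
  obtain ⟨B, _, f, b, rfl, hf⟩ := hX.exists_finitePresentation_map_eq_zero a x' hx
  have hy : Y.obj.map f y' = 0 := by
    refine hθ B ?_
    rw [naturality_apply, h, ← naturality_apply, hf, map_zero, map_zero]
  rw [map_comp_apply, hy, map_zero]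

theorem LiftRel.unique (hX : PreservesDirectLimits R X)
    (hθ : ∀ (A : ModuleCat.{u} R) [Module.FinitePresentation R A], Function.Injective (θ.app A))
    {S : ModuleCat.{u} R} {x : X.obj.obj S} {y y' : Y.obj.obj S} (h : LiftRel θ η x y)
    (h' : LiftRel θ η x y') : y = y' := by
  have := h.add h'.neg
  rw [add_neg_cancel] at this
  exact eq_of_sub_eq_zero ((sub_eq_add_neg y y').trans (this.eq_zero hX hθ))

theorem LiftRel.exists (hX : PreservesDirectLimits R X)
    (hθ : ∀ (A : ModuleCat.{u} R) [Module.FinitePresentation R A], Function.Surjective (θ.app A))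
    {S : ModuleCat.{u} R} (x : X.obj.obj S) : ∃ y, LiftRel θ η x y := by
  obtain ⟨A, hA, a, x', rfl⟩ := hX.exists_finitePresentation_rep x
  obtain ⟨y', hy'⟩ := hθ A (η.app A x')
  exact ⟨Y.obj.map a y', A, hA, a, x', y', rfl, rfl, hy'⟩

variable (θ η)

/-- A natural transformation into `T` lifts along a natural transformation which is bijective on
finitely presented modules. -/
theorem exists_lift_of_bijective (hX : PreservesDirectLimits R X)
    (hθ : ∀ (A : ModuleCat.{u} R) [Module.FinitePresentation R A], Function.Bijective (θ.app A)) :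
    ∃ φ : X.obj ⟶ Y.obj, φ ≫ θ = η := by
  have hex {S : ModuleCat.{u} R} (x : X.obj.obj S) : ∃ y, LiftRel θ η x y :=
    LiftRel.exists hX (fun A _ => (hθ A).2) x
  have hun {S : ModuleCat.{u} R} {x : X.obj.obj S} {y y' : Y.obj.obj S} (h : LiftRel θ η x y)
      (h' : LiftRel θ η x y') : y = y' := h.unique hX (fun A _ => (hθ A).1) h'
  refine ⟨{ app S := AddCommGrpCat.ofHom (AddMonoidHom.mk' (fun x => (hex x).choose) fun x x' =>
              hun (hex _).choose_spec ((hex x).choose_spec.add (hex x').choose_spec))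
            naturality S S' f := AddCommGrpCat.hom_ext (AddMonoidHom.ext fun x =>
              hun (hex _).choose_spec ((hex x).choose_spec.map f)) }, ?_⟩
  ext S x
  exact (hex x).choose_spec.app_eq

end

/-- Lifting the identity gives a section of `θ`; cancelling `θ` makes it an inverse. -/
theorem isIso_of_bijective_on_finitePresentation {X Y : FunctorModule R}
    (hX : PreservesDirectLimits R X) (hY : PreservesDirectLimits R Y) (θ : X.obj ⟶ Y.obj)
    (hθ : ∀ (A : ModuleCat.{u} R) [Module.FinitePresentation R A], Function.Bijective (θ.app A)) :
    IsIso θ := by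
  obtain ⟨φ, hφ⟩ := exists_lift_of_bijective θ (𝟙 Y.obj) hY hθ
  refine ⟨φ, eq_of_comp_eq hX θ (fun A _ => (hθ A).1) ?_, hφ⟩
  rw [Category.assoc, hφ, Category.comp_id, Category.id_comp]

end Extension

/-! ### The pure embedding into the double dual -/

section DoubleDual

variable (M : ModuleCat.{u} Rᵐᵒᵖ)

/-- The character module of a right `R`-module, as a left `R`-module. -/
abbrev dualModule : ModuleCat.{u} R := ModuleCat.of R (CoHom M (AddCircle (1 : ℚ)))

/-- The evaluation of morphisms `S ⟶ Hom(M, ℚ/ℤ)` at pure tensors. -/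
def evalAt {S : ModuleCat.{u} R} (m : M) (s : S) : (characters (dualModule M)).obj.obj S :=
  (characterHom _).symm (AddMonoidHom.mk' (fun u => u s m) fun _ _ => rfl)

/-- The canonical morphism from `M` to its double dual. -/
def toDoubleDual : M ⟶ baseModule (characters (dualModule M)) :=
  ModuleCat.ofHom
    { toFun m := evalAt M m (1 : ModuleCat.of R R)
      map_add' m m' := characters_ext fun u => map_add (u (1 : ModuleCat.of R R)) m m'
      map_smul' r m := characters_ext fun u => by
        change u (1 : R) (r • m) = u (LinearMap.toSpanSingleton R R r.unop (1 : R)) m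
        rw [LinearMap.toSpanSingleton_apply, one_smul]
        conv_rhs => rw [← mul_one r.unop]
        exact (DFunLike.congr_fun (map_smul u.hom r.unop (1 : R)) m).symm }

/-- A character detecting `t` corresponds to some `u : S ⟶ M*`; comparing the image of `t` with D(S)
and evaluating at `u` recovers its value on `t`. -/
theorem isPure_toDoubleDual : IsPure (toDoubleDual M) := by
  intro S
  rw [injective_iff_map_eq_zero]
  intro t ht
  by_contra hne
  obtain ⟨χ, hχ⟩ := CharacterModule.exists_character_apply_ne_zero_of_ne_zero hne
  let u : S ⟶ dualModule M := ModuleCat.ofHom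
    (rtensorHomEquiv (M := M) (S := S) (Z := AddCircle (1 : ℚ)) χ)
  let ev : RTensor R M S →+ AddCircle (1 : ℚ) :=
    ((AddMonoidHom.eval u).comp (characterHom _).toAddMonoidHom).comp
      ((comparisonHom (characters (dualModule M)) S).comp
        (rtmap (R := R) (toDoubleDual M).hom (LinearMap.id : S →ₗ[R] S)).toAddMonoidHom)
  have hev : ev = χ := rtensor_addHom_ext fun m s => by
    change u (LinearMap.toSpanSingleton R S s (1 : R)) m = χ (rtmul R m s)
    rw [LinearMap.toSpanSingleton_apply, one_smul]
    rfl
  refine hχ ?_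
  rw [← hev]
  exact (congrArg (((AddMonoidHom.eval u).comp (characterHom _).toAddMonoidHom).comp
      (comparisonHom (characters (dualModule M)) S)) ht).trans (map_zero _)

end DoubleDual

/-! ### The two implications -/

theorem injective_quasiCoherent {M : ModuleCat.{u} Rᵐᵒᵖ} (hM : IsPureInjective M) :
    Injective (⟨quasiCoherent M, quasiCoherent_preservesDirectLimits M⟩ :
      DirectLimitFunctor R) where
  factors {X Y} g f _ := by
    let F := characters (dualModule M)
    obtain ⟨r, hr⟩ := hM (toDoubleDual M) (isPure_toDoubleDual M) (𝟙 M)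
    obtain ⟨h, hh⟩ := exists_comp_eq_of_injective f.hom.hom (injective_of_mono f _)
      (g.hom.hom ≫ quasiCoherentMap (toDoubleDual M) ≫ comparison F)
    have hF : ∀ (A : ModuleCat.{u} R) [Module.FinitePresentation R A],
        Function.Bijective ((comparison F).app A) := fun A _ =>
      characters_rightExactOnFP.comparison_bijective A
    -- The comparison for `F` is only known to be bijective on finitely presented modules; this
    -- suffices because `Y` preserves direct limits.
    obtain ⟨k, hk⟩ := exists_lift_of_bijective (comparison F) h Y.property hF
    have hfk : f.hom.hom ≫ k = g.hom.hom ≫ quasiCoherentMap (toDoubleDual M) :=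
      eq_of_comp_eq X.property (comparison F) (fun A _ => (hF A).1) (by
        rw [Category.assoc, hk, hh, Category.assoc])
    refine ⟨⟨⟨k ≫ quasiCoherentMap r⟩⟩, ?_⟩
    have hr' : quasiCoherentMap (toDoubleDual M) ≫ quasiCoherentMap r = 𝟙 (quasiCoherent M).obj :=
      quasiCoherent_hom_ext fun S m s =>
        congrArg (fun m' => rtmul R m' s) (ConcreteCategory.congr_hom hr m)
    ext1
    ext1
    change f.hom.hom ≫ k ≫ quasiCoherentMap r = g.hom.hom
    rw [← Category.assoc, hfk, Category.assoc, hr', Category.comp_id]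

variable {F : FunctorModule R} (hF : PreservesDirectLimits R F)

theorem isIso_comparison_of_injective [Injective (⟨F, hF⟩ : DirectLimitFunctor R)] :
    IsIso (comparison F) :=
  isIso_of_bijective_on_finitePresentation (quasiCoherent_preservesDirectLimits _) hF _
    fun A _ => (rightExactOnFP_of_injective (⟨F, hF⟩ : DirectLimitFunctor R)).comparison_bijective A

/-- Purity makes the induced transformation a monomorphism. The extension is read off at `R` on the
elements n ⊗ 1, and naturality under right multiplications gives linearity. -/
theorem isPureInjective_of_injective [Injective (⟨F, hF⟩ : DirectLimitFunctor R)] :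
    IsPureInjective (baseModule F) := by
  intro N N' f hf h
  let X : DirectLimitFunctor R := ⟨quasiCoherent N, quasiCoherent_preservesDirectLimits N⟩
  let Y : DirectLimitFunctor R := ⟨quasiCoherent N', quasiCoherent_preservesDirectLimits N'⟩
  let i : X ⟶ Y := ⟨⟨quasiCoherentMap f⟩⟩
  have : Mono i := mono_of_injective i hf
  let g : X ⟶ ⟨F, hF⟩ := ⟨⟨quasiCoherentMap h ≫ comparison F⟩⟩
  let k : (quasiCoherent N').obj ⟶ F.obj := (Injective.factorThru g i).hom.hom
  have hk : quasiCoherentMap f ≫ k = quasiCoherentMap h ≫ comparison F :=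
    congrArg (fun t => t.hom.hom) (Injective.comp_factorThru g i)
  let k' : N' →ₗ[Rᵐᵒᵖ] BaseValue F :=
    { toFun n := k.app (ModuleCat.of R R) (rtmul R n (1 : R))
      map_add' n n' := (congrArg (k.app (ModuleCat.of R R)) (add_rtmul n n' (1 : R))).trans
        (map_add (k.app (ModuleCat.of R R)).hom _ _)
      map_smul' r n := by
        refine (congrArg (k.app (ModuleCat.of R R)) ?_).trans
          (naturality_apply k (fromOne (S := ModuleCat.of R R) r.unop) (rtmul R n (1 : R)))
        refine (smul_rtmul r.unop n (1 : R)).trans (congrArg (rtmul R n) ?_)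
        simp }
  refine ⟨ModuleCat.ofHom k', ?_⟩
  ext n
  refine (ConcreteCategory.congr_hom (NatTrans.congr_app hk (ModuleCat.of R R))
    (rtmul R n (1 : R) : RTensor R N R)).trans ?_
  change F.obj.map (fromOne (1 : ModuleCat.of R R)) (h n) = h n
  rw [fromOne_one, map_id_apply]

end QsCh

end

theorem mainTheorem10 {R : Type u} [Ring R] (F : QsCh.FunctorModule R) :
    (∃ hF : QsCh.PreservesDirectLimits R F,
        CategoryTheory.Injective (⟨F, hF⟩ : QsCh.DirectLimitFunctor R)) ↔
      ∃ M : ModuleCat.{u} Rᵐᵒᵖ, QsCh.IsPureInjective M ∧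
        Nonempty (F ≅ QsCh.quasiCoherent M) := by
  constructor
  · rintro ⟨hF, _⟩
    have := QsCh.isIso_comparison_of_injective hF
    exact ⟨QsCh.baseModule F, QsCh.isPureInjective_of_injective hF,
      ⟨(ObjectProperty.isoMk _ (asIso (QsCh.comparison F))).symm⟩⟩
  · rintro ⟨M, hM, ⟨e⟩⟩
    have hF : QsCh.PreservesDirectLimits R F := fun I _ _ _ => by
      have : PreservesColimitsOfShape I ((additiveFunctor _ _).ι.obj (QsCh.quasiCoherent M)) :=
        QsCh.quasiCoherent_preservesDirectLimits M I
      exact preservesColimitsOfShape_of_natIso ((additiveFunctor _ _).ι.mapIso e).symm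
    exact ⟨hF, Injective.of_iso (ObjectProperty.isoMk _ e.symm)
      (QsCh.injective_quasiCoherent hM)⟩
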